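/- Fix an integer $W\ge 0$ (the back-off window) and real parameters $\lambda>0$ (Poisson arrival rate), $\sigma>0$ (length of a mini-slot), $T>0$ (length of a normal slot) and $0\le r<1$ (probability that the channel is busy). An isolated greedy station is the Markov chain $(K,N)$ on the states $(0,0)$ and $(k,n)$, $0\le k\le W$, $n\ge1$ ($K$ is the back-off counter, $N$ the number of packets), observed slot by slot. During a slot of length $t$ a Poisson number, with mean $\lambda t$, of packets arrives; slot selections, arrivals and back-off draws are independent. The transitions are as follows. * From $(0,0)$: the slot has length $T$ with probability $r$ and $\sigma$ with probability $1-r$; if $j$ packets arrive, the next state is $(0,0)$ if $j=0$, and $(U,j)$ with $U$ uniform on $\{0,\dots,W\}$ if $j\ge1$. * From $(0,n)$, $n\ge1$: the slot has length $T$ and one packet is transmitted; if $j$ packets arrive, the next state is $(0,0)$ if $n-1+j=0$, and otherwise $(U,n-1+j)$ with $U$ uniform on $\{0,\dots,W\}$. * From $(k,n)$, $k\ge1$, $n\ge1$: with probability $r$ the slot has length $T$ and the next state is $(k,n+j)$; with probability $1-r$ the slot has length $\sigma$ and the next state is $(k-1,n+j)$; here $j$ is the number of arrivals in the slot. Put $$u(x)=\frac{1-re^{-\lambda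 T(1-x)}}{(1-r)e^{-\lambda\sigma(1-x)}},\qquad R(x)=\frac{e^{-\lambda T(1-x)}}{x}-\frac{(W+1)\,u(x)^W(1-u(x))}{1-u(x)^{W+1}},\qquad B=T+\frac{W[rT+(1-r)\sigma]}{2(1-r)},$$ where $\frac{1-u^{W+1}}{1-u}$ is read as $1+u+\dots+u^W$ (in particular at $x=1$, where $u(1)=1$). **Theorem.** $R$ is differentiable at $1$ and $R'(1)=\lambda B-1$. The chain is ergodic (irreducible, aperiodic and positive recurrent) if and only if $R'(1)=\lambda B-1<0$, that is, if and only if $$\lambda<\frac{1}{T\left[1+\frac{rW}{2(1-r)}\right]+\frac{W\sigma}{2}}.$$ In other words, for each $W$, the boundary of the ergodicity region in the parameter space $\{(\lambda,\sigma,T,r):\lambda,\sigma,T>0,\ 0\le r<1\}$ (with its topology as a subset of $\mathbb R^4$) is the surface $$\lambda\bigl[(Wr+2(1-r))T+W(1-r)\sigma\bigr]=2(1-r).$$ -/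

import Mathlib

noncomputable section

namespace MarkovChain

open scoped ENNReal

/-! Discrete-time Markov chains on a countable state space `E`, given by their one-step transition
probabilities `P : E → PMF E`. -/

variable {E : Type*}

/-- `nStep P n x y` is the probability of being in `y` after `n` steps, starting from `x`. -/
def nStep (P : E → PMF E) : ℕ → E → PMF E
  | 0, x => PMF.pure x
  | n + 1, x => (P x).bind (nStep P n)

/-- Every state can be reached from every state. -/
def IsIrreducible (P : E → PMF E) : Prop :=
  ∀ x y, ∃ n, 0 < nStep P n x y

/-- For every state `x`, the gcd of the possible return times to `x` is `1`. -/
def IsAperiodic (P : E → PMF E) : Prop :=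
  ∀ x, ∀ d : ℕ, (∀ n, 1 ≤ n → 0 < nStep P n x x → d ∣ n) → d = 1

open Classical in
/-- `firstPassage P y n x` is the probability that the chain started from `x` visits `y` for the
first time strictly after time `0` exactly at time `n + 1`. -/
def firstPassage (P : E → PMF E) (y : E) : ℕ → E → ℝ≥0∞
  | 0, x => P x y
  | n + 1, x => ∑' z, if z = y then 0 else P x z * firstPassage P y n z

/-- Every state `x` is positive recurrent: the chain started from `x` returns to `x` with
probability one, and the mean return time is finite. -/
def IsPositiveRecurrent (P : E → PMF E) : Prop :=
  ∀ x, ∑' n, firstPassage P x n x = 1 ∧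
    ∑' n, ((n + 1 : ℕ) : ℝ≥0∞) * firstPassage P x n x < ∞

/-- A Markov chain on a countable state space is ergodic if it is irreducible, aperiodic and
positive recurrent. -/
structure IsErgodic (P : E → PMF E) : Prop where
  irreducible : IsIrreducible P
  aperiodic : IsAperiodic P
  positiveRecurrent : IsPositiveRecurrent P

end MarkovChain

namespace Greedy

open ProbabilityTheory

/-- The continuous parameters of the model. -/
structure Params where
  /-- rate of the Poisson arrival process -/
  lam : ℝ
  /-- duration of a mini-slot -/
  σ : ℝ
  /-- duration of a normal slot, that is, of a packet transmission -/
  T : ℝ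
  /-- probability that the channel is busy -/
  r : ℝ
  lam_pos : 0 < lam
  σ_pos : 0 < σ
  T_pos : 0 < T
  r_nonneg : 0 ≤ r
  r_lt_one : r < 1

/-- The parameter space carries the topology of a subset of `ℝ⁴`. -/
instance : TopologicalSpace Params :=
  TopologicalSpace.induced (fun p => (p.lam, p.σ, p.T, p.r)) inferInstance

/-- States `(K, N)` of the station: `K ∈ {0, …, W}` is the back-off counter and `N` the number of
packets; the back-off counter of an empty station is `0`. -/
abbrev State (W : ℕ) : Type := {s : Fin (W + 1) × ℕ // s.2 = 0 → s.1 = 0}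

/-- State of a station holding `n` packets for which the back-off number `k` has been drawn (the
number is discarded if there is no packet). -/
def backoffState {W : ℕ} (k : Fin (W + 1)) (n : ℕ) : State W :=
  if h : n = 0 then ⟨(0, 0), fun _ => rfl⟩ else ⟨(k, n), fun h0 => absurd h0 h⟩

/-- Law of the channel indicator: busy (`true`) with probability `r`, idle with `1 - r`. -/
def busyLaw (p : Params) : PMF Bool :=
  (bernoulliMeasure true false (⟨p.r, p.r_nonneg, p.r_lt_one.le⟩ : unitInterval)).toPMF

/-- Law of the number of Poisson arrivals during a time interval of length `t`. -/
def arrivalLaw (p : Params) (t : ℝ) : PMF ℕ :=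
  (poissonMeasure (p.lam * t).toNNReal).toPMF

/-- Law of a back-off number: uniform on `{0, …, W}`. -/
def backoffLaw (W : ℕ) : PMF (Fin (W + 1)) := PMF.uniformOfFintype (Fin (W + 1))

/-- Length of the slot: `T` if the channel is busy, `σ` if it is idle. -/
def slotLength (p : Params) (busy : Bool) : ℝ := if busy then p.T else p.σ

/-- One-step transition probabilities of the greedy station, observed at the ends of the slots.
* Empty station: a random slot takes place; if packets arrive, a back-off number is drawn.
* Back-off counter at `0`, with a pending packet: the station transmits in a slot of length `T`,
  and a new back-off number is drawn if packets remain.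
* Positive back-off counter: a random slot takes place; the counter is decreased by one
  if it is a mini-slot, and kept if it is a normal slot. -/
def transition (W : ℕ) (p : Params) (s : State W) : PMF (State W) :=
  if s.1.2 = 0 then
    (busyLaw p).bind fun busy =>
    (arrivalLaw p (slotLength p busy)).bind fun j =>
    (backoffLaw W).bind fun k =>
    PMF.pure (backoffState k j)
  else if s.1.1 = 0 then
    (arrivalLaw p p.T).bind fun j =>
    (backoffLaw W).bind fun k =>
    PMF.pure (backoffState k (s.1.2 - 1 + j))
  else
    (busyLaw p).bind fun busy =>
    (arrivalLaw p (slotLength p busy)).bind fun j =>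
    PMF.pure (backoffState (if busy then s.1.1 else s.1.1 - 1) (s.1.2 + j))

/-- `B = T + W [r T + (1 - r) σ] / (2 (1 - r))`. -/
def B (W : ℕ) (p : Params) : ℝ :=
  p.T + W * (p.r * p.T + (1 - p.r) * p.σ) / (2 * (1 - p.r))

/-- `a(x) = (1 - r) e^{-λσ(1-x)}`. -/
def a (p : Params) (x : ℂ) : ℂ := (1 - p.r) * Complex.exp (-(p.lam * p.σ * (1 - x)))

/-- `b(x) = 1 - r e^{-λT(1-x)}`. -/
def b (p : Params) (x : ℂ) : ℂ := 1 - p.r * Complex.exp (-(p.lam * p.T * (1 - x)))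

/-- `u(x) = b(x) / a(x)`. -/
def u (p : Params) (x : ℂ) : ℂ := b p x / a p x

/-- `R(x) = e^{-λT(1-x)} / x - (W + 1) u(x)^W (1 - u(x)) / (1 - u(x)^{W+1})`, where the last
quotient is written with `(1 - u^{W+1}) / (1 - u) = 1 + u + ⋯ + u^W`, which also gives its value
at `x = 1`, where `u(1) = 1`. -/
def R (W : ℕ) (p : Params) (x : ℂ) : ℂ :=
  Complex.exp (-(p.lam * p.T * (1 - x))) / x
    - (W + 1) * u p x ^ W / ∑ i ∈ Finset.range (W + 1), u p x ^ i

theorem R_eq (W : ℕ) (p : Params) (x : ℂ) (hx : u p x ≠ 1) :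
    R W p x = Complex.exp (-(p.lam * p.T * (1 - x))) / x
      - (W + 1) * u p x ^ W * (1 - u p x) / (1 - u p x ^ (W + 1)) := by
  have h : (1 - u p x) ≠ 0 := sub_ne_zero.mpr (Ne.symm hx)
  have hs : 1 - u p x ^ (W + 1) = (∑ i ∈ Finset.range (W + 1), u p x ^ i) * (1 - u p x) := by
    rw [geom_sum_mul_neg]
  rw [R, hs, mul_div_mul_right _ _ h]

end Greedy

end

/-! Use the workload n + ck as a test function, giving the empty station the virtual counter W/2. A
fresh back-off draw has mean W/2, so the mean change of the workload is `slotLoad` at the empty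
state, λT + cW/2 - 1 at a transmission, and `slotLoad` - (1-r)c while the counter is positive. For c
= `backoffWeight` the last drift vanishes and the transmission drift is exactly λB - 1
(`lam_mul_B`).

If λB < 1, a slightly larger c makes both drifts off the empty state negative, and Foster's
criterion (`return_of_drift`) gives positive recurrence. If λB ≥ 1, the workload is subharmonic off
the empty state and strictly increases on average when leaving it. At most one packet departs per
slot, so the workload is at most a multiple of the mean emptying time; optional stopping, in the
form of `not_return_of_subharmonic`, then excludes a finite mean return time. Irreducibility and
aperiodicity hold because the empty state leads everywhere in one step and is accessible from
everywhere.

The frontier follows by continuity and by decreasing λ; R'(1) is a direct computation. -/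

noncomputable section

/-! ### Killed chains, return times and Foster-type criteria -/

namespace MarkovChain

open scoped ENNReal Topology
open Filter

/-- The expectation of a nonnegative function with respect to a discrete law. -/
def expect {E : Type*} (q : PMF E) (f : E → ℝ≥0∞) : ℝ≥0∞ := ∑' z, q z * f z

section Expect

variable {E F : Type*}

theorem expect_pure (x : E) (f : E → ℝ≥0∞) : expect (PMF.pure x) f = f x := by
  classical
  simp [expect, PMF.pure_apply]

theorem expect_bind (q : PMF E) (g : E → PMF F) (f : F → ℝ≥0∞) :
    expect (q.bind g) f = expect q fun a => expect (g a) f := by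
  simp only [expect, PMF.bind_apply, ← ENNReal.tsum_mul_right, ← ENNReal.tsum_mul_left, mul_assoc]
  exact ENNReal.tsum_comm

theorem expect_const (q : PMF E) (c : ℝ≥0∞) : expect q (fun _ => c) = c := by
  simp [expect, ENNReal.tsum_mul_right, q.tsum_coe]

theorem expect_add (q : PMF E) (f g : E → ℝ≥0∞) :
    expect q (fun x => f x + g x) = expect q f + expect q g := by
  simp only [expect, mul_add, ENNReal.tsum_add]

theorem expect_bool (q : PMF Bool) (f : Bool → ℝ≥0∞) :
    expect q f = q true * f true + q false * f false := by
  rw [expect, tsum_fintype, Fintype.sum_bool]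

end Expect

variable {E : Type*}

open Classical in
/-- The one-step operator of the chain killed upon entering `y`. -/
def killed (P : E → PMF E) (y : E) (f : E → ℝ≥0∞) (x : E) : ℝ≥0∞ :=
  ∑' z, if z = y then 0 else P x z * f z

/-- `survival P y n x` is the probability that the chain started from `x` does not visit `y` at
the times `1, …, n`. -/
def survival (P : E → PMF E) (y : E) : ℕ → E → ℝ≥0∞
  | 0, _ => 1
  | n + 1, x => killed P y (survival P y n) x

theorem killed_add_self (P : E → PMF E) (y : E) (f : E → ℝ≥0∞) (x : E) :
    killed P y f x + P x y * f y = expect (P x) f := by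
  classical
  rw [expect, ENNReal.tsum_eq_add_tsum_ite y, add_comm, killed]

theorem killed_le_expect (P : E → PMF E) (y : E) (f : E → ℝ≥0∞) (x : E) :
    killed P y f x ≤ expect (P x) f :=
  le_self_add.trans (killed_add_self P y f x).le

theorem killed_mono (P : E → PMF E) {y : E} {f g : E → ℝ≥0∞} (h : ∀ z, z ≠ y → f z ≤ g z) (x : E) :
    killed P y f x ≤ killed P y g x := by
  refine ENNReal.tsum_le_tsum fun z => ?_
  split_ifs with hz
  · exact le_rfl
  · exact mul_le_mul_right (h z hz) _

theorem killed_congr (P : E → PMF E) {y : E} {f g : E → ℝ≥0∞} (h : ∀ z, z ≠ y → f z = g z) (x : E) :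
    killed P y f x = killed P y g x :=
  le_antisymm (killed_mono P (fun z hz => (h z hz).le) x)
    (killed_mono P (fun z hz => (h z hz).ge) x)

theorem killed_add (P : E → PMF E) (y : E) (f g : E → ℝ≥0∞) (x : E) :
    killed P y (fun z => f z + g z) x = killed P y f x + killed P y g x := by
  simp only [killed, ← ENNReal.tsum_add]
  refine tsum_congr fun z => ?_
  split_ifs
  · simp
  · ring

theorem killed_mul_left (P : E → PMF E) (y : E) (c : ℝ≥0∞) (f : E → ℝ≥0∞) (x : E) :
    killed P y (fun z => c * f z) x = c * killed P y f x := by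
  simp only [killed, ← ENNReal.tsum_mul_left]
  refine tsum_congr fun z => ?_
  split_ifs
  · simp
  · ring

theorem killed_sum {ι : Type*} (P : E → PMF E) (y : E) (s : Finset ι) (f : ι → E → ℝ≥0∞) (x : E) :
    killed P y (fun z => ∑ i ∈ s, f i z) x = ∑ i ∈ s, killed P y (f i) x := by
  classical
  induction s using Finset.induction_on with
  | empty => simp [killed]
  | insert i s hi ih => simp only [Finset.sum_insert hi, killed_add, ih]

theorem killed_tsum {ι : Type*} (P : E → PMF E) (y : E) (f : ι → E → ℝ≥0∞) (x : E) :
    killed P y (fun z => ∑' i, f i z) x = ∑' i, killed P y (f i) x := by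
  simp only [killed]
  rw [ENNReal.tsum_comm]
  refine tsum_congr fun z => ?_
  split_ifs
  · simp
  · rw [ENNReal.tsum_mul_left]

theorem killed_one_add (P : E → PMF E) (y x : E) : killed P y (fun _ => 1) x + P x y = 1 := by
  have h := killed_add_self P y (fun _ => 1) x
  rwa [mul_one, expect_const] at h

theorem survival_one (P : E → PMF E) (y x : E) :
    survival P y 1 x = killed P y (fun _ => 1) x := rfl

theorem firstPassage_succ (P : E → PMF E) (y : E) (n : ℕ) (x : E) :
    firstPassage P y (n + 1) x = killed P y (firstPassage P y n) x := rfl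

theorem firstPassage_add_survival (P : E → PMF E) (y : E) (n : ℕ) (x : E) :
    firstPassage P y n x + survival P y (n + 1) x = survival P y n x := by
  induction n generalizing x with
  | zero => rw [survival_one, add_comm]; exact killed_one_add P y x
  | succ n ih =>
    rw [firstPassage_succ, survival, ← killed_add]
    exact killed_congr P (fun z _ => ih z) x

theorem survival_le_one (P : E → PMF E) (y : E) (n : ℕ) (x : E) : survival P y n x ≤ 1 := by
  induction n with
  | zero => exact le_rfl
  | succ n ih => exact (firstPassage_add_survival P y n x ▸ le_add_self).trans ih

theorem survival_ne_top (P : E → PMF E) (y : E) (n : ℕ) (x : E) : survival P y n x ≠ ∞ :=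
  ((survival_le_one P y n x).trans_lt ENNReal.one_lt_top).ne

theorem sum_firstPassage_add_survival (P : E → PMF E) (y : E) (N : ℕ) (x : E) :
    ∑ n ∈ Finset.range N, firstPassage P y n x + survival P y N x = 1 := by
  induction N with
  | zero => simp [survival]
  | succ N ih => rw [Finset.sum_range_succ, add_assoc, firstPassage_add_survival, ih]

/-- Summation by parts: it converts mean return times into sums of survival probabilities. -/
theorem sum_mul_firstPassage_add_survival (P : E → PMF E) (y : E) (N : ℕ) (x : E) :
    ∑ n ∈ Finset.range N, ((n + 1 : ℕ) : ℝ≥0∞) * firstPassage P y n x + N * survival P y N x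
      = ∑ n ∈ Finset.range N, survival P y n x := by
  induction N with
  | zero => simp
  | succ N ih =>
    rw [Finset.sum_range_succ, Finset.sum_range_succ, ← ih, add_assoc, ← mul_add,
      firstPassage_add_survival]
    push_cast
    ring

/-- If the probabilities of late returns are summable, the return is certain and its mean time
is finite. -/
theorem return_of_tsum_survival (P : E → PMF E) (y : E) (h : ∑' n, survival P y n y ≠ ∞) :
    ∑' n, firstPassage P y n y = 1 ∧
      ∑' n, ((n + 1 : ℕ) : ℝ≥0∞) * firstPassage P y n y < ∞ := by
  constructor
  · have h1 : Tendsto (fun N => ∑ n ∈ Finset.range N, firstPassage P y n y + survival P y N y)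
        atTop (𝓝 (∑' n, firstPassage P y n y + 0)) :=
      (ENNReal.tendsto_nat_tsum _).add (ENNReal.tendsto_atTop_zero_of_tsum_ne_top h)
    simp only [sum_firstPassage_add_survival, add_zero] at h1
    exact tendsto_nhds_unique h1 tendsto_const_nhds
  · refine lt_of_le_of_lt ?_ h.lt_top
    rw [ENNReal.tsum_eq_iSup_nat]
    refine iSup_le fun N => ?_
    calc _ ≤ ∑ n ∈ Finset.range N, survival P y n y :=
          sum_mul_firstPassage_add_survival P y N y ▸ le_self_add
      _ ≤ _ := ENNReal.sum_le_tsum _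

theorem sum_range_add_tsum (f : ℕ → ℝ≥0∞) (N : ℕ) :
    ∑ i ∈ Finset.range N, f i + ∑' i, f (i + N) = ∑' i, f i :=
  Summable.sum_add_tsum_nat_add' (f := f) (k := N) ENNReal.summable

/-- If the return is certain and its mean time is finite, the probabilities of late returns
are summable. -/
theorem tsum_survival_ne_top (P : E → PMF E) (y : E) (h1 : ∑' n, firstPassage P y n y = 1)
    (h2 : ∑' n, ((n + 1 : ℕ) : ℝ≥0∞) * firstPassage P y n y < ∞) :
    ∑' n, survival P y n y ≠ ∞ := by
  refine (lt_of_le_of_lt ?_ h2).ne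
  rw [ENNReal.tsum_eq_iSup_nat]
  refine iSup_le fun N => ?_
  -- As the return is certain, survival is the tail of the return law, so N times it is at most the
  -- tail of the mean.
  have hs : survival P y N y = ∑' i, firstPassage P y (i + N) y := by
    have hN := sum_firstPassage_add_survival P y N y
    have hN' := sum_range_add_tsum (fun i => firstPassage P y i y) N
    rw [h1] at hN'
    refine (ENNReal.add_right_inj ?_).1 (hN.trans hN'.symm)
    exact ((le_self_add.trans hN.le).trans_lt ENNReal.one_lt_top).ne
  rw [← sum_mul_firstPassage_add_survival, hs, ← ENNReal.tsum_mul_left,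
    ← sum_range_add_tsum (fun i => ((i + 1 : ℕ) : ℝ≥0∞) * firstPassage P y i y) N]
  refine add_le_add_right (ENNReal.tsum_le_tsum fun i => mul_le_mul_left ?_ (firstPassage P y _ y)) _
  exact_mod_cast (by omega : N ≤ i + N + 1)

/-- Foster's criterion for the returns to a state. -/
theorem return_of_drift (P : E → PMF E) (y : E) (V : E → ℝ≥0∞) {δ : ℝ≥0∞} (hδ : δ ≠ 0)
    (hV : ∀ x, x ≠ y → killed P y V x + δ ≤ V x) (hy : killed P y V y ≠ ∞) :
    ∑' n, firstPassage P y n y = 1 ∧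
      ∑' n, ((n + 1 : ℕ) : ℝ≥0∞) * firstPassage P y n y < ∞ := by
  have key : ∀ N x, x ≠ y → δ * ∑ n ∈ Finset.range N, survival P y n x ≤ V x := by
    intro N
    induction N with
    | zero => simp
    | succ N ih =>
      intro x hx
      refine le_trans ?_ (hV x hx)
      rw [Finset.sum_range_succ', mul_add]
      refine add_le_add ?_ (by simp [survival])
      change δ * ∑ n ∈ Finset.range N, killed P y (survival P y n) x ≤ _
      rw [← killed_sum, ← killed_mul_left]
      exact killed_mono P ih x
  have key' : ∀ x, x ≠ y → δ * ∑' n, survival P y n x ≤ V x := by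
    intro x hx
    rw [ENNReal.tsum_eq_iSup_nat, ENNReal.mul_iSup]
    exact iSup_le fun N => key N x hx
  refine return_of_tsum_survival P y ?_
  -- The drift condition says nothing at y itself, so one step out of y is taken first.
  rw [tsum_eq_zero_add' ENNReal.summable]
  refine ENNReal.add_ne_top.2 ⟨by simp [survival], fun h => hy ?_⟩
  have h1 : δ * ∑' n, survival P y (n + 1) y ≤ killed P y V y := by
    change δ * ∑' n, killed P y (survival P y n) y ≤ _
    rw [← killed_tsum, ← killed_mul_left]
    exact killed_mono P key' y
  rw [h, ENNReal.mul_top hδ] at h1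
  exact top_le_iff.1 h1

/-- A function which is bounded by a multiple of the mean hitting time of `y`, is subharmonic off
`y`, and increases strictly on average in the step out of `y` prevents positive recurrence. -/
theorem not_return_of_subharmonic (P : E → PMF E) (y : E) (V : E → ℝ≥0∞) {C d : ℝ≥0∞}
    (hC : C ≠ ∞) (hd : d ≠ 0) (hy : V y ≠ ∞) (hV : ∀ x, x ≠ y → V x ≤ expect (P x) V)
    (hyV : V y + d ≤ expect (P y) V) (hb : ∀ x, x ≠ y → V x ≤ C * ∑' n, survival P y n x)
    (h1 : ∑' n, firstPassage P y n y = 1)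
    (h2 : ∑' n, ((n + 1 : ℕ) : ℝ≥0∞) * firstPassage P y n y < ∞) : False := by
  have hs := tsum_survival_ne_top P y h1 h2
  -- Q n x is the expectation of V(X_n) on the event that y is not visited at times 1, …, n.
  set Q : ℕ → E → ℝ≥0∞ := fun n => (killed P y)^[n] V with hQ
  have hQs : ∀ n x, Q (n + 1) x = killed P y (Q n) x := fun n x =>
    congrFun (Function.iterate_succ_apply' (killed P y) n V) x
  have hup : ∀ n x, x ≠ y → Q n x ≤ C * ∑' i, survival P y (i + n) x := by
    intro n
    induction n with
    | zero => exact hb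
    | succ n ih =>
      intro x _
      rw [hQs]
      change _ ≤ C * ∑' i, killed P y (survival P y (i + n)) x
      rw [← killed_tsum, ← killed_mul_left]
      exact killed_mono P ih x
  have hupy : ∀ n, Q (n + 1) y ≤ C * ∑' i, survival P y (i + (n + 1)) y := by
    intro n
    rw [hQs]
    change _ ≤ C * ∑' i, killed P y (survival P y (i + n)) y
    rw [← killed_tsum, ← killed_mul_left]
    exact killed_mono P (hup n) y
  have hstep : ∀ x, killed P y V x + V y = expect (P x) V + V y * survival P y 1 x := by
    intro x
    rw [← killed_add_self P y V x, add_assoc]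
    congr 1
    rw [survival_one, mul_comm (P x y), ← mul_add, add_comm, killed_one_add, mul_one]
  -- The expectation of V(X_n) - V(y) on the event of no visit is nondecreasing in n; written
  -- additively to avoid subtraction in `ℝ≥0∞`.
  have hstep' : ∀ n x, x ≠ y → Q n x + V y * survival P y (n + 1) x
      ≤ Q (n + 1) x + V y * survival P y n x := by
    intro n
    induction n with
    | zero =>
      intro x hx
      rw [hQs]
      simp only [hQ, Function.iterate_zero, id, survival, mul_one]
      exact (add_le_add_left (hV x hx) _).trans (hstep x).ge
    | succ n ih =>
      intro x _
      rw [hQs, hQs, survival, survival, ← killed_mul_left, ← killed_mul_left,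
        ← killed_add, ← killed_add]
      exact killed_mono P ih x
  have hlow : ∀ n, d + V y * survival P y (n + 1) y ≤ Q (n + 1) y := by
    intro n
    induction n with
    | zero =>
      have h := hstep y
      have h3 : d + V y * survival P y 1 y + V y ≤ killed P y V y + V y := by
        rw [h, add_comm _ (V y), ← add_assoc]
        exact add_le_add_left hyV _
      exact (ENNReal.add_le_add_iff_right hy).1 h3
    | succ n ih =>
      have h3 : Q (n + 1) y + V y * survival P y (n + 2) y
          ≤ Q (n + 2) y + V y * survival P y (n + 1) y := by
        rw [hQs, hQs, survival, survival, ← killed_mul_left, ← killed_mul_left,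
          ← killed_add, ← killed_add]
        exact killed_mono P (hstep' n) y
      have h4 := (add_le_add_left ih (V y * survival P y (n + 2) y)).trans h3
      rw [add_right_comm] at h4
      exact (ENNReal.add_le_add_iff_right
        (ENNReal.mul_ne_top hy (survival_ne_top P y _ y))).1 h4
  -- The upper bound is a tail of a convergent series, whereas `hlow` keeps Q above d.
  have hlim := ENNReal.Tendsto.const_mul
    ((tendsto_add_atTop_iff_nat 1).2 (ENNReal.tendsto_sum_nat_add _ hs)) (Or.inr hC)
  rw [mul_zero] at hlim
  exact hd (le_zero_iff.1 (ge_of_tendsto' hlim fun n =>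
    (le_self_add.trans (hlow n)).trans (hupy n)))

/-! ### Irreducibility and aperiodicity from a hub state -/

theorem nStep_one (P : E → PMF E) (x y : E) : nStep P 1 x y = P x y := by
  have : nStep P 1 x = P x := PMF.bind_pure _
  rw [this]

theorem nStep_pos_add (P : E → PMF E) {m n : ℕ} {x y z : E} (h1 : 0 < nStep P m x y)
    (h2 : 0 < nStep P n y z) : 0 < nStep P (m + n) x z := by
  induction m generalizing x with
  | zero =>
    have : x = y := by
      by_contra h
      simp [nStep, PMF.pure_apply, Ne.symm h] at h1
    simpa [this] using h2
  | succ m ih =>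
    rw [Nat.add_right_comm]
    rw [PMF.apply_pos_iff] at h1 ⊢
    simp only [nStep, PMF.mem_support_bind_iff] at h1 ⊢
    obtain ⟨w, hw, hwy⟩ := h1
    exact ⟨w, hw, (PMF.apply_pos_iff _ _).1 (ih ((PMF.apply_pos_iff _ _).2 hwy))⟩

/-- A chain with a state that leads to every state in one step, and is accessible from every state,
is irreducible. -/
theorem isIrreducible_of_hub (P : E → PMF E) (y : E) (h1 : ∀ x, 0 < P y x)
    (h2 : ∀ x, ∃ n, 0 < nStep P n x y) : IsIrreducible P := by
  intro x z
  obtain ⟨n, hn⟩ := h2 x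
  exact ⟨n + 1, nStep_pos_add P hn (nStep_one P y z ▸ h1 z)⟩

/-- A chain with a state that leads to every state in one step, and is accessible from every state,
is aperiodic. -/
theorem isAperiodic_of_hub (P : E → PMF E) (y : E) (h1 : ∀ x, 0 < P y x)
    (h2 : ∀ x, ∃ n, 0 < nStep P n x y) : IsAperiodic P := by
  intro x d hd
  obtain ⟨n, hn⟩ := h2 x
  have hy : ∀ z, 0 < nStep P 1 y z := fun z => nStep_one P y z ▸ h1 z
  -- Waiting one step at the hub gives the consecutive return times n + 1 and n + 2.
  have ha := hd _ (by omega) (nStep_pos_add P hn (hy x))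
  have hb := hd _ (by omega) (nStep_pos_add P (nStep_pos_add P hn (hy y)) (hy x))
  exact Nat.dvd_one.1 ((Nat.dvd_add_right ha).1 hb)

end MarkovChain

end

/-! ### Slot laws and the drift of the workload -/

noncomputable section

namespace Greedy

open MarkovChain ProbabilityTheory
open scoped ENNReal

theorem busyLaw_true (p : Params) : busyLaw p true = ENNReal.ofReal p.r := by
  rw [busyLaw, MeasureTheory.Measure.toPMF_apply,
    bernoulliMeasure_apply _ (MeasurableSet.singleton _)]
  simp only [Set.mem_singleton_iff, if_true, Bool.false_eq_true, if_false]
  rw [ENNReal.ofReal, Real.toNNReal_of_nonneg p.r_nonneg]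
  rfl

theorem busyLaw_false (p : Params) : busyLaw p false = ENNReal.ofReal (1 - p.r) := by
  have h := (busyLaw p).tsum_coe
  rw [tsum_fintype, Fintype.sum_bool, busyLaw_true] at h
  rw [ENNReal.ofReal_sub _ p.r_nonneg, ENNReal.ofReal_one]
  exact ENNReal.eq_sub_of_add_eq ENNReal.ofReal_ne_top (by rw [add_comm, h])

theorem busyLaw_false_pos (p : Params) : 0 < busyLaw p false := by
  rw [busyLaw_false, ENNReal.ofReal_pos]
  exact sub_pos.2 p.r_lt_one

theorem expect_busyLaw_ofReal (p : Params) {g : Bool → ℝ} (hg : ∀ b, 0 ≤ g b) :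
    expect (busyLaw p) (fun b => ENNReal.ofReal (g b))
      = ENNReal.ofReal (p.r * g true + (1 - p.r) * g false) := by
  have h1 : 0 ≤ 1 - p.r := sub_nonneg.2 p.r_lt_one.le
  rw [expect_bool, busyLaw_true, busyLaw_false, ← ENNReal.ofReal_mul p.r_nonneg,
    ← ENNReal.ofReal_mul h1, ← ENNReal.ofReal_add (mul_nonneg p.r_nonneg (hg _))
      (mul_nonneg h1 (hg _))]

theorem arrivalLaw_apply (p : Params) {t : ℝ} (ht : 0 ≤ t) (n : ℕ) :
    arrivalLaw p t n
      = ENNReal.ofReal (Real.exp (-(p.lam * t)) * (p.lam * t) ^ n / n.factorial) := by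
  rw [arrivalLaw, MeasureTheory.Measure.toPMF_apply, poissonMeasure_singleton,
    Real.coe_toNNReal _ (mul_nonneg p.lam_pos.le ht)]

theorem arrivalLaw_pos (p : Params) {t : ℝ} (ht : 0 < t) (n : ℕ) : 0 < arrivalLaw p t n := by
  have := mul_pos p.lam_pos ht
  rw [arrivalLaw_apply p ht.le, ENNReal.ofReal_pos]
  positivity

theorem expect_arrivalLaw_natCast (p : Params) {t : ℝ} (ht : 0 ≤ t) :
    expect (arrivalLaw p t) (fun j => (j : ℝ≥0∞)) = ENNReal.ofReal (p.lam * t) := by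
  have h0 : 0 ≤ p.lam * t := mul_nonneg p.lam_pos.le ht
  rw [expect, tsum_eq_zero_add' ENNReal.summable]
  have h : ∀ n : ℕ, arrivalLaw p t (n + 1) * ((n + 1 : ℕ) : ℝ≥0∞)
      = ENNReal.ofReal (p.lam * t) * arrivalLaw p t n := by
    intro n
    rw [arrivalLaw_apply p ht, arrivalLaw_apply p ht, ← ENNReal.ofReal_natCast,
      ← ENNReal.ofReal_mul (by positivity), ← ENNReal.ofReal_mul h0, Nat.factorial_succ]
    congr 1
    push_cast
    field_simp
    ring
  simp only [h, ENNReal.tsum_mul_left, PMF.tsum_coe]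
  simp

theorem expect_arrivalLaw_ofReal (p : Params) {t x : ℝ} (ht : 0 ≤ t) (hx : 0 ≤ x) :
    expect (arrivalLaw p t) (fun j => ENNReal.ofReal (x + j))
      = ENNReal.ofReal (x + p.lam * t) := by
  simp only [ENNReal.ofReal_add hx (Nat.cast_nonneg _), ENNReal.ofReal_natCast]
  rw [expect_add, expect_const, expect_arrivalLaw_natCast p ht,
    ENNReal.ofReal_add hx (mul_nonneg p.lam_pos.le ht)]

theorem backoffLaw_apply (W : ℕ) (k : Fin (W + 1)) :
    backoffLaw W k = ENNReal.ofReal ((W + 1 : ℝ)⁻¹) := by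
  rw [backoffLaw, PMF.uniformOfFintype_apply, Fintype.card_fin,
    ENNReal.ofReal_inv_of_pos (by positivity)]
  congr 1
  rw [← Nat.cast_succ, ENNReal.ofReal_natCast]

theorem backoffLaw_pos (W : ℕ) (k : Fin (W + 1)) : 0 < backoffLaw W k := by
  rw [backoffLaw_apply, ENNReal.ofReal_pos]
  positivity

theorem expect_backoffLaw_ofReal (W : ℕ) {x c : ℝ} (hx : 0 ≤ x) (hc : 0 ≤ c) :
    expect (backoffLaw W) (fun k => ENNReal.ofReal (x + c * (k : ℕ)))
      = ENNReal.ofReal (x + c * W / 2) := by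
  have hw : (0 : ℝ) ≤ (W + 1 : ℝ)⁻¹ := by positivity
  simp only [expect, tsum_fintype, backoffLaw_apply, ← ENNReal.ofReal_mul hw]
  rw [← ENNReal.ofReal_sum_of_nonneg (fun k _ => by positivity)]
  congr 1
  have hs : (∑ k : Fin (W + 1), ((k : ℕ) : ℝ)) * 2 = (W + 1) * W := by
    rw [Fin.sum_univ_eq_sum_range (fun i => (i : ℝ))]
    have h := congrArg (Nat.cast : ℕ → ℝ) (Finset.sum_range_id_mul_two (W + 1))
    rwa [Nat.add_sub_cancel, Nat.cast_mul, Nat.cast_mul, Nat.cast_sum, Nat.cast_ofNat,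
      Nat.cast_succ] at h
  rw [← Finset.mul_sum, Finset.sum_add_distrib, ← Finset.mul_sum,
    eq_div_of_mul_eq two_ne_zero hs, Finset.sum_const, Finset.card_univ, Fintype.card_fin,
    nsmul_eq_mul]
  push_cast
  field_simp

/-- The empty state. -/
def empty (W : ℕ) : State W := ⟨(0, 0), fun _ => rfl⟩

theorem eq_empty_iff {W : ℕ} (s : State W) : s = empty W ↔ s.1.2 = 0 := by
  refine ⟨fun h => h ▸ rfl, fun h => ?_⟩
  exact Subtype.ext (Prod.ext (s.2 h) h)

theorem backoffState_eta {W : ℕ} (s : State W) : backoffState s.1.1 s.1.2 = s := by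
  unfold backoffState
  split_ifs with h
  · exact ((eq_empty_iff s).2 h).symm
  · rfl

theorem backoffState_snd {W : ℕ} (k : Fin (W + 1)) (n : ℕ) : (backoffState k n).1.2 = n := by
  unfold backoffState
  split_ifs with h
  · exact h.symm
  · rfl

theorem backoffState_fst {W : ℕ} (k : Fin (W + 1)) {n : ℕ} (hn : n ≠ 0) :
    (backoffState k n).1.1 = k := by
  simp [backoffState, hn]

/-- The number of packets plus `c` times the back-off counter, where a virtual back-off counter
equal to the mean `W / 2` is attributed to the empty station. -/
def workload {W : ℕ} (c : ℝ) (s : State W) : ℝ :=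
  if s.1.2 = 0 then c * W / 2 else s.1.2 + c * (s.1.1 : ℕ)

theorem workload_nonneg {W : ℕ} {c : ℝ} (hc : 0 ≤ c) (s : State W) : 0 ≤ workload c s := by
  unfold workload
  split_ifs <;> positivity

theorem workload_backoffState {W : ℕ} (c : ℝ) (k : Fin (W + 1)) {n : ℕ} (hn : n ≠ 0) :
    workload c (backoffState k n) = n + c * (k : ℕ) := by
  rw [workload, backoffState_snd, if_neg hn, backoffState_fst k hn]

/-- The virtual counter W/2 of the empty station makes one formula valid for n = 0 as well. -/
theorem expect_backoffLaw_workload {W : ℕ} {c : ℝ} (hc : 0 ≤ c) (n : ℕ) :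
    expect (backoffLaw W) (fun k => ENNReal.ofReal (workload c (backoffState k n)))
      = ENNReal.ofReal (c * W / 2 + n) := by
  rcases eq_or_ne n 0 with rfl | hn
  · simp only [workload, backoffState_snd, if_true]
    simp [expect_const]
  · simp only [workload_backoffState c _ hn]
    rw [expect_backoffLaw_ofReal W (Nat.cast_nonneg n) hc, add_comm]

theorem slotLength_pos (p : Params) (b : Bool) : 0 < slotLength p b := by
  cases b <;> simp [slotLength, p.σ_pos, p.T_pos]

/-- The mean number of arrivals during a random slot. -/
def slotLoad (p : Params) : ℝ := p.lam * (p.r * p.T + (1 - p.r) * p.σ)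

theorem slotLoad_pos (p : Params) : 0 < slotLoad p :=
  mul_pos p.lam_pos (add_pos_of_nonneg_of_pos (mul_nonneg p.r_nonneg p.T_pos.le)
    (mul_pos (sub_pos.2 p.r_lt_one) p.σ_pos))

theorem expect_transition_empty {W : ℕ} (p : Params) {c : ℝ} (hc : 0 ≤ c) :
    expect (transition W p (empty W)) (fun s => ENNReal.ofReal (workload c s))
      = ENNReal.ofReal (slotLoad p + c * W / 2) := by
  have hW : 0 ≤ c * W / 2 := by positivity
  have := p.lam_pos.le
  rw [transition, if_pos (by rfl)]
  simp only [expect_bind, expect_pure, expect_backoffLaw_workload hc]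
  simp only [expect_arrivalLaw_ofReal p (slotLength_pos p _).le hW]
  rw [expect_busyLaw_ofReal p fun b => by have := (slotLength_pos p b).le; positivity]
  congr 1
  simp only [slotLength, slotLoad, if_true, Bool.false_eq_true, if_false]
  ring

theorem expect_transition_zero {W : ℕ} (p : Params) {c : ℝ} (hc : 0 ≤ c) (s : State W)
    (hn : s.1.2 ≠ 0) (hk : s.1.1 = 0) :
    expect (transition W p s) (fun s => ENNReal.ofReal (workload c s))
      = ENNReal.ofReal (workload c s + (p.lam * p.T + c * W / 2 - 1)) := by
  obtain ⟨n, hn'⟩ := Nat.exists_eq_succ_of_ne_zero hn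
  have h0 : (0 : ℝ) ≤ c * W / 2 + n := by positivity
  rw [transition, if_neg hn, if_pos hk]
  simp only [expect_bind, expect_pure, expect_backoffLaw_workload hc, hn', Nat.succ_sub_one,
    Nat.cast_add, ← add_assoc]
  rw [expect_arrivalLaw_ofReal p p.T_pos.le h0, workload, if_neg hn, hk, hn']
  congr 1
  push_cast
  simp
  ring

theorem expect_transition_pos {W : ℕ} (p : Params) {c : ℝ} (hc : 0 ≤ c) (s : State W)
    (hn : s.1.2 ≠ 0) (hk : s.1.1 ≠ 0) :
    expect (transition W p s) (fun s => ENNReal.ofReal (workload c s))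
      = ENNReal.ofReal (workload c s + (slotLoad p - (1 - p.r) * c)) := by
  have := p.lam_pos.le
  rw [transition, if_neg hn, if_neg hk]
  have h (k : Fin (W + 1)) (j : ℕ) : workload c (backoffState k (s.1.2 + j))
      = (s.1.2 + c * (k : ℕ)) + j := by
    rw [workload_backoffState c k (by omega)]
    push_cast
    ring
  have h0 (k : Fin (W + 1)) : 0 ≤ (s.1.2 : ℝ) + c * (k : ℕ) := by positivity
  simp only [expect_bind, expect_pure, h]
  simp only [expect_arrivalLaw_ofReal p (slotLength_pos p _).le (h0 _)]
  rw [expect_busyLaw_ofReal p fun b =>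
    add_nonneg (h0 _) (mul_nonneg p.lam_pos.le (slotLength_pos p b).le)]
  congr 1
  have hk' : ((s.1.1 - 1 : Fin (W + 1)) : ℕ) = (s.1.1 : ℕ) - 1 := Fin.val_sub_one_of_ne_zero hk
  have hk1 : 1 ≤ (s.1.1 : ℕ) := Nat.one_le_iff_ne_zero.2 fun h => hk (Fin.ext h)
  simp only [slotLength, slotLoad, if_true, Bool.false_eq_true, if_false, workload, if_neg hn, hk']
  push_cast [hk1]
  ring

/-! ### Irreducibility and aperiodicity -/

theorem transition_empty_pos {W : ℕ} (p : Params) (s : State W) :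
    0 < transition W p (empty W) s := by
  rw [PMF.apply_pos_iff, transition, if_pos (by rfl)]
  simp only [PMF.mem_support_bind_iff, PMF.mem_support_pure_iff]
  exact ⟨false, (busyLaw_false_pos p).ne', s.1.2, (arrivalLaw_pos p (slotLength_pos p _) _).ne',
    s.1.1, (backoffLaw_pos W _).ne', (backoffState_eta s).symm⟩

theorem transition_zero_pos {W : ℕ} (p : Params) (s : State W) (hn : s.1.2 ≠ 0)
    (hk : s.1.1 = 0) : 0 < transition W p s (backoffState 0 (s.1.2 - 1)) := by
  rw [PMF.apply_pos_iff, transition, if_neg hn, if_pos hk]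
  simp only [PMF.mem_support_bind_iff, PMF.mem_support_pure_iff]
  exact ⟨0, (arrivalLaw_pos p p.T_pos _).ne', 0, (backoffLaw_pos W _).ne', rfl⟩

theorem transition_pos_pos {W : ℕ} (p : Params) (s : State W) (hn : s.1.2 ≠ 0)
    (hk : s.1.1 ≠ 0) : 0 < transition W p s (backoffState (s.1.1 - 1) s.1.2) := by
  rw [PMF.apply_pos_iff, transition, if_neg hn, if_neg hk]
  simp only [PMF.mem_support_bind_iff, PMF.mem_support_pure_iff]
  exact ⟨false, (busyLaw_false_pos p).ne', 0, (arrivalLaw_pos p (slotLength_pos p _) _).ne', rfl⟩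

/-- Without arrivals, idle slots run the counter down and each transmission removes a packet;
drawing 0 each time suffices. -/
theorem exists_nStep_empty_pos {W : ℕ} (p : Params) (s : State W) :
    ∃ m, 0 < nStep (transition W p) m s (empty W) := by
  suffices h : ∀ n k, ∀ s : State W, s.1.2 = n → (s.1.1 : ℕ) = k →
      ∃ m, 0 < nStep (transition W p) m s (empty W) from h _ _ s rfl rfl
  intro n
  induction n with
  | zero =>
    intro k s hn _
    rw [(eq_empty_iff s).2 hn]
    exact ⟨0, by simp [nStep]⟩
  | succ n ihn =>
    intro k
    induction k with
    | zero =>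
      intro s hn hk
      obtain ⟨m, hm⟩ := ihn _ (backoffState 0 (s.1.2 - 1))
        (by rw [backoffState_snd, hn, Nat.add_sub_cancel]) rfl
      refine ⟨1 + m, nStep_pos_add _ ?_ hm⟩
      rw [nStep_one]
      exact transition_zero_pos p s (by omega) (Fin.ext hk)
    | succ k ihk =>
      intro s hn hk
      have hk0 : s.1.1 ≠ 0 := fun h => by rw [h] at hk; simp at hk
      have hn0 : s.1.2 ≠ 0 := by omega
      obtain ⟨m, hm⟩ := ihk (backoffState (s.1.1 - 1) s.1.2) (by rw [backoffState_snd, hn])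
        (by rw [backoffState_fst _ hn0, Fin.val_sub_one_of_ne_zero hk0, hk, Nat.add_sub_cancel])
      refine ⟨1 + m, nStep_pos_add _ ?_ hm⟩
      rw [nStep_one]
      exact transition_pos_pos p s hn0 hk0

end Greedy

end

/-! ### Ergodicity criterion -/

noncomputable section

namespace Greedy

open MarkovChain ProbabilityTheory Filter
open scoped ENNReal Topology

/-- The weight of a back-off unit for which the workload has no drift while the counter is
positive. -/
def backoffWeight (p : Params) : ℝ := slotLoad p / (1 - p.r)

theorem backoffWeight_pos (p : Params) : 0 < backoffWeight p :=
  div_pos (slotLoad_pos p) (sub_pos.2 p.r_lt_one)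

theorem lam_mul_B (W : ℕ) (p : Params) :
    p.lam * B W p = p.lam * p.T + backoffWeight p * W / 2 := by
  have : 1 - p.r ≠ 0 := (sub_pos.2 p.r_lt_one).ne'
  rw [B, backoffWeight, slotLoad]
  field_simp

theorem one_le_packets {W : ℕ} {s : State W} (hs : s ≠ empty W) : (1 : ℝ) ≤ s.1.2 := by
  have : s.1.2 ≠ 0 := fun h => hs ((eq_empty_iff s).2 h)
  exact_mod_cast Nat.one_le_iff_ne_zero.2 this

theorem expect_workload_ne_top {W : ℕ} (p : Params) {c : ℝ} (hc : 0 ≤ c) (s : State W) :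
    expect (transition W p s) (fun s => ENNReal.ofReal (workload c s)) ≠ ∞ := by
  by_cases hs : s = empty W
  · rw [hs, expect_transition_empty p hc]
    exact ENNReal.ofReal_ne_top
  · have hn : s.1.2 ≠ 0 := fun h => hs ((eq_empty_iff s).2 h)
    by_cases hk : s.1.1 = 0
    · rw [expect_transition_zero p hc s hn hk]
      exact ENNReal.ofReal_ne_top
    · rw [expect_transition_pos p hc s hn hk]
      exact ENNReal.ofReal_ne_top

/-- Below the critical load, the workload has a negative drift off the empty state. -/
theorem exists_workload_drift (W : ℕ) (p : Params) (h : p.lam * B W p < 1) :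
    ∃ c δ : ℝ, 0 ≤ c ∧ 0 < δ ∧ ∀ s : State W, s ≠ empty W →
      expect (transition W p s) (fun s => ENNReal.ofReal (workload c s)) + ENNReal.ofReal δ
        ≤ ENNReal.ofReal (workload c s) := by
  have hr : 0 < 1 - p.r := sub_pos.2 p.r_lt_one
  have hW : (0 : ℝ) < W + 1 := by positivity
  -- With weight `backoffWeight p + ε` the drift is -(1-r)ε during back-off and λB - 1 + εW/2 = -ε -
  -- εW/2 at a transmission.
  set ε := (1 - p.lam * B W p) / (W + 1) with hε
  have hε0 : 0 < ε := div_pos (sub_pos.2 h) hW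
  have hεW : ε * W + ε = 1 - p.lam * B W p := by rw [hε]; field_simp
  have hc0 := backoffWeight_pos p
  have hlT := mul_pos p.lam_pos p.T_pos
  have hload := slotLoad_pos p
  have hl : (1 - p.r) * backoffWeight p = slotLoad p := mul_div_cancel₀ _ hr.ne'
  have hc : 0 ≤ backoffWeight p + ε := (add_pos hc0 hε0).le
  refine ⟨backoffWeight p + ε, min ((1 - p.r) * ε) ε, hc,
    lt_min (mul_pos hr hε0) hε0, fun s hs => ?_⟩
  have hn : s.1.2 ≠ 0 := fun h => hs ((eq_empty_iff s).2 h)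
  have h1 := one_le_packets hs
  have hδ : 0 ≤ min ((1 - p.r) * ε) ε := (lt_min (mul_pos hr hε0) hε0).le
  have hwW : 0 ≤ (backoffWeight p + ε) * W / 2 := by positivity
  have hεW0 : 0 ≤ ε * W := by positivity
  by_cases hk : s.1.1 = 0
  · have hw : workload (backoffWeight p + ε) s = s.1.2 := by simp [workload, hn, hk]
    rw [expect_transition_zero p hc s hn hk, hw, ← ENNReal.ofReal_add (by linarith) hδ]
    refine ENNReal.ofReal_le_ofReal ?_
    have := min_le_right ((1 - p.r) * ε) ε
    have := lam_mul_B W p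
    nlinarith
  · have hk1 : (1 : ℝ) ≤ (s.1.1 : ℕ) := by
      exact_mod_cast Nat.one_le_iff_ne_zero.2 fun h => hk (Fin.ext h)
    -- Together with `hrc`, this makes the expected workload a nonnegative real, as
    -- `ENNReal.ofReal_add` requires.
    have hw : backoffWeight p + ε ≤ workload (backoffWeight p + ε) s := by
      rw [workload, if_neg hn]
      have := le_mul_of_one_le_right hc hk1
      linarith
    have hrc : (1 - p.r) * (backoffWeight p + ε) ≤ backoffWeight p + ε :=
      mul_le_of_le_one_left hc (by linarith [p.r_nonneg])
    rw [expect_transition_pos p hc s hn hk, ← ENNReal.ofReal_add (by linarith) hδ]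
    refine ENNReal.ofReal_le_ofReal ?_
    have := min_le_left ((1 - p.r) * ε) ε
    rw [mul_add, hl]
    linarith

theorem isPositiveRecurrent_of_lt (W : ℕ) (p : Params) (h : p.lam * B W p < 1) :
    IsPositiveRecurrent (transition W p) := by
  obtain ⟨c, δ, hc, hδ, hdrift⟩ := exists_workload_drift W p h
  intro y
  set P := transition W p
  set V : State W → ℝ≥0∞ := fun s => ENNReal.ofReal (workload c s)
  have hq0 : P (empty W) y ≠ 0 := (transition_empty_pos p y).ne'
  have hq1 : P (empty W) y ≠ ∞ := PMF.apply_ne_top _ _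
  -- For y other than the empty state, the drift of V fails at the empty state. Adding C to V
  -- repairs it: killing at y loses C times P(empty, y) in that step.
  set C : ℝ≥0∞ := (expect (P (empty W)) V + ENNReal.ofReal δ) / P (empty W) y
  have hC : C * P (empty W) y = expect (P (empty W)) V + ENNReal.ofReal δ :=
    ENNReal.div_mul_cancel hq0 hq1
  have hCtop : C ≠ ∞ := ENNReal.div_ne_top
    (ENNReal.add_ne_top.2 ⟨expect_workload_ne_top p hc _, ENNReal.ofReal_ne_top⟩) hq0
  have hle : ∀ x, killed P y (fun s => V s + C) x ≤ expect (P x) V + C := by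
    intro x
    refine (killed_le_expect _ _ _ _).trans ?_
    rw [expect_add, expect_const]
  refine return_of_drift P y (fun s => V s + C) (ENNReal.ofReal_pos.2 hδ).ne' (fun x hx => ?_)
    (ne_top_of_le_ne_top (ENNReal.add_ne_top.2 ⟨expect_workload_ne_top p hc y, hCtop⟩) (hle y))
  by_cases hx0 : x = empty W
  · subst hx0
    have hk : killed P y (fun s => V s + C) (empty W)
        ≤ expect (P (empty W)) V + C * killed P y (fun _ => 1) (empty W) := by
      rw [killed_add, ← killed_mul_left]
      simp only [mul_one]
      exact add_le_add_left (killed_le_expect _ _ _ _) _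
    calc _ ≤ expect (P (empty W)) V + C * killed P y (fun _ => 1) (empty W)
          + ENNReal.ofReal δ := add_le_add_left hk _
      _ = C * (killed P y (fun _ => 1) (empty W) + P (empty W) y) := by
          rw [mul_add, hC]; ring
      _ = C := by rw [killed_one_add, mul_one]
      _ ≤ _ := le_add_self
  · calc _ ≤ expect (P x) V + C + ENNReal.ofReal δ := add_le_add_left (hle x) _
      _ = expect (P x) V + ENNReal.ofReal δ + C := by ring
      _ ≤ _ := add_le_add_left (hdrift x hx0) _

theorem packets_le_of_transition_ne_zero {W : ℕ} (p : Params) (s z : State W)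
    (h : transition W p s z ≠ 0) : s.1.2 ≤ z.1.2 + 1 := by
  rw [transition] at h
  split_ifs at h with h0 hk
  · omega
  · simp only [← PMF.mem_support_iff, PMF.mem_support_bind_iff, PMF.mem_support_pure_iff] at h
    obtain ⟨j, -, k, -, rfl⟩ := h
    rw [backoffState_snd]
    omega
  · simp only [← PMF.mem_support_iff, PMF.mem_support_bind_iff, PMF.mem_support_pure_iff] at h
    obtain ⟨b, -, j, -, rfl⟩ := h
    rw [backoffState_snd]
    omega

/-- A station with `n` packets needs at least `n` slots to become empty. -/
theorem survival_empty_eq_one {W : ℕ} (p : Params) (m : ℕ) (s : State W) (h : m < s.1.2) :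
    survival (transition W p) (empty W) m s = 1 := by
  induction m generalizing s with
  | zero => rfl
  | succ m ih =>
    rw [survival, killed, ← (transition W p s).tsum_coe]
    refine tsum_congr fun z => ?_
    by_cases hz : transition W p s z = 0
    · simp [hz]
    · have := packets_le_of_transition_ne_zero p s z hz
      rw [if_neg fun h0 => by rw [(eq_empty_iff z).1 h0] at this; omega,
        ih z (by omega), mul_one]

theorem packets_le_tsum_survival {W : ℕ} (p : Params) (s : State W) :
    (s.1.2 : ℝ≥0∞) ≤ ∑' n, survival (transition W p) (empty W) n s := by
  refine le_trans (le_of_eq ?_) (ENNReal.sum_le_tsum (Finset.range s.1.2))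
  rw [Finset.sum_congr rfl fun m hm => survival_empty_eq_one p m s (Finset.mem_range.1 hm)]
  simp

theorem not_isPositiveRecurrent_of_le (W : ℕ) (p : Params) (h : 1 ≤ p.lam * B W p) :
    ¬ IsPositiveRecurrent (transition W p) := by
  intro hpos
  have hc := (backoffWeight_pos p).le
  have hr : 0 < 1 - p.r := sub_pos.2 p.r_lt_one
  obtain ⟨h1, h2⟩ := hpos (empty W)
  -- C comes from n + ck ≤ n + cW ≤ (1 + cW)n for n ≥ 1, and d is the drift at the empty state.
  refine not_return_of_subharmonic (transition W p) (empty W)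
    (fun s => ENNReal.ofReal (workload (backoffWeight p) s))
    (C := ENNReal.ofReal (1 + backoffWeight p * W)) (d := ENNReal.ofReal (slotLoad p))
    ENNReal.ofReal_ne_top (ENNReal.ofReal_pos.2 (slotLoad_pos p)).ne' ENNReal.ofReal_ne_top
    (fun s hs => ?_) ?_ (fun s hs => ?_) h1 h2
  · have hn : s.1.2 ≠ 0 := fun h => hs ((eq_empty_iff s).2 h)
    by_cases hk : s.1.1 = 0
    · rw [expect_transition_zero p hc s hn hk]
      refine ENNReal.ofReal_le_ofReal ?_
      linarith [lam_mul_B W p]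
    · rw [expect_transition_pos p hc s hn hk]
      refine ENNReal.ofReal_le_ofReal ?_
      rw [backoffWeight, mul_div_cancel₀ _ hr.ne', sub_self, add_zero]
  · rw [expect_transition_empty p hc, ← ENNReal.ofReal_add (workload_nonneg hc _)
      (slotLoad_pos p).le]
    refine ENNReal.ofReal_le_ofReal ?_
    rw [workload, if_pos (by rfl), add_comm]
  · have hn : s.1.2 ≠ 0 := fun h => hs ((eq_empty_iff s).2 h)
    refine le_trans ?_ (mul_le_mul_right (packets_le_tsum_survival p s) _)
    rw [← ENNReal.ofReal_natCast, ← ENNReal.ofReal_mul (by positivity)]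
    refine ENNReal.ofReal_le_ofReal ?_
    rw [workload, if_neg hn]
    have hkW : ((s.1.1 : ℕ) : ℝ) ≤ W := by exact_mod_cast Fin.is_le s.1.1
    have h3 := mul_le_mul_of_nonneg_left hkW hc
    have h4 := le_mul_of_one_le_right (by positivity : 0 ≤ backoffWeight p * W) (one_le_packets hs)
    linarith

theorem isErgodic_iff (W : ℕ) (p : Params) :
    IsErgodic (transition W p) ↔ p.lam * B W p < 1 := by
  refine ⟨fun h => ?_, fun h => ⟨?_, ?_, isPositiveRecurrent_of_lt W p h⟩⟩
  · by_contra hlt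
    exact not_isPositiveRecurrent_of_le W p (not_lt.1 hlt) h.positiveRecurrent
  · exact isIrreducible_of_hub _ (empty W) (transition_empty_pos p) (exists_nStep_empty_pos p)
  · exact isAperiodic_of_hub _ (empty W) (transition_empty_pos p) (exists_nStep_empty_pos p)

/-! ### Explicit ergodicity region and its frontier -/

theorem B_eq (W : ℕ) (p : Params) :
    B W p = p.T * (1 + p.r * W / (2 * (1 - p.r))) + W * p.σ / 2 := by
  have : 1 - p.r ≠ 0 := (sub_pos.2 p.r_lt_one).ne'
  rw [B]
  field_simp
  ring

theorem B_pos (W : ℕ) (p : Params) : 0 < B W p := by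
  have h1 : 0 ≤ 1 - p.r := sub_nonneg.2 p.r_lt_one.le
  have h2 := p.r_nonneg
  have h3 := p.σ_pos.le
  have h4 := p.T_pos
  rw [B]
  positivity

theorem lam_mul_B_mul (W : ℕ) (p : Params) : p.lam * B W p * (2 * (1 - p.r))
    = p.lam * ((W * p.r + 2 * (1 - p.r)) * p.T + W * (1 - p.r) * p.σ) := by
  have : 1 - p.r ≠ 0 := (sub_pos.2 p.r_lt_one).ne'
  rw [B]
  field_simp
  ring

theorem isErgodic_iff_polynomial (W : ℕ) (p : Params) : IsErgodic (transition W p) ↔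
    p.lam * ((W * p.r + 2 * (1 - p.r)) * p.T + W * (1 - p.r) * p.σ) < 2 * (1 - p.r) := by
  have : 0 < 2 * (1 - p.r) := mul_pos two_pos (sub_pos.2 p.r_lt_one)
  rw [isErgodic_iff, ← lam_mul_B_mul, mul_lt_iff_lt_one_left this]

theorem continuous_coords :
    Continuous fun p : Params => (p.lam, p.σ, p.T, p.r) := continuous_induced_dom

theorem continuous_lam : Continuous Params.lam := continuous_coords.fst

theorem continuous_σ : Continuous Params.σ := continuous_coords.snd.fst

theorem continuous_T : Continuous Params.T := continuous_coords.snd.snd.fst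

theorem continuous_r : Continuous Params.r := continuous_coords.snd.snd.snd

/-- The parameters with the arrival rate multiplied by `t`. -/
def Params.scale (p : Params) (t : ℝ) (ht : 0 < t) : Params :=
  { p with lam := t * p.lam, lam_pos := mul_pos ht p.lam_pos }

theorem frontier_isErgodic (W : ℕ) :
    frontier {p : Params | IsErgodic (transition W p)} =
      {p : Params |
        p.lam * ((W * p.r + 2 * (1 - p.r)) * p.T + W * (1 - p.r) * p.σ) = 2 * (1 - p.r)} := by
  simp only [isErgodic_iff_polynomial]
  have hl := continuous_lam
  have hσ := continuous_σ
  have hT := continuous_T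
  have hr := continuous_r
  have hf : Continuous fun p : Params =>
    p.lam * ((W * p.r + 2 * (1 - p.r)) * p.T + W * (1 - p.r) * p.σ) := by fun_prop
  have hg : Continuous fun p : Params => 2 * (1 - p.r) := by fun_prop
  refine Set.Subset.antisymm (frontier_lt_subset_eq hf hg) fun p hp => ?_
  rw [(isOpen_lt hf hg).frontier_eq]
  refine ⟨?_, fun h => h.ne hp⟩
  -- A critical point is the limit of ergodic ones with smaller λ; the shift by 2 keeps the factor
  -- positive at n = 0.
  have ht0 : ∀ n : ℕ, 0 < 1 - 1 / ((n : ℝ) + 2) := fun n => by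
    rw [sub_pos, div_lt_one (by positivity)]
    linarith [(Nat.cast_nonneg n : (0 : ℝ) ≤ n)]
  have hlim : Tendsto (fun n : ℕ => 1 - 1 / ((n : ℝ) + 2)) atTop (𝓝 1) := by
    have h := (tendsto_const_div_atTop_nhds_zero_nat (1 : ℝ)).comp (tendsto_add_atTop_nat 2)
    simpa [Function.comp_def] using h.const_sub 1
  refine mem_closure_of_tendsto (f := fun n : ℕ => p.scale _ (ht0 n)) (b := atTop) ?_
    (Eventually.of_forall fun n => ?_)
  · rw [nhds_induced, tendsto_comap_iff]
    have h1 := hlim.mul_const p.lam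
    rw [one_mul] at h1
    exact h1.prodMk_nhds tendsto_const_nhds
  · have hp' : p.lam * ((W * p.r + 2 * (1 - p.r)) * p.T + W * (1 - p.r) * p.σ)
        = 2 * (1 - p.r) := hp
    have h0 : 0 < 2 * (1 - p.r) := mul_pos two_pos (sub_pos.2 p.r_lt_one)
    have h1 : 1 - 1 / ((n : ℝ) + 2) < 1 := sub_lt_self 1 (by positivity)
    change (1 - 1 / ((n : ℝ) + 2)) * p.lam *
      ((W * p.r + 2 * (1 - p.r)) * p.T + W * (1 - p.r) * p.σ) < 2 * (1 - p.r)
    rw [mul_assoc, hp']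
    exact mul_lt_of_lt_one_left h0 h1

/-! ### The derivative of `R` at `1` -/

theorem hasDerivAt_exp_one (m : ℂ) :
    HasDerivAt (fun x : ℂ => Complex.exp (-(m * (1 - x)))) m 1 := by
  have h : HasDerivAt (fun x : ℂ => -(m * (1 - x))) m 1 := by
    simpa using (((hasDerivAt_id (1 : ℂ)).const_sub 1).const_mul m).fun_neg
  simpa using h.cexp

theorem one_sub_r_ne_zero (p : Params) : (1 : ℂ) - p.r ≠ 0 := by
  exact_mod_cast (sub_pos.2 p.r_lt_one).ne'

theorem a_one (p : Params) : a p 1 = 1 - p.r := by simp [a]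

theorem b_one (p : Params) : b p 1 = 1 - p.r := by simp [b]

theorem u_one (p : Params) : u p 1 = 1 := by
  rw [u, a_one, b_one, div_self (one_sub_r_ne_zero p)]

/-- Since a(1) = b(1) = 1 - r, the derivative is (b'(1) - a'(1)) / (1 - r): the driftless weight
reappears. -/
theorem hasDerivAt_u (p : Params) : HasDerivAt (u p) (-(backoffWeight p : ℂ)) 1 := by
  have ha : HasDerivAt (a p) ((1 - p.r) * (p.lam * p.σ)) 1 :=
    (hasDerivAt_exp_one (p.lam * p.σ)).const_mul _
  have hb : HasDerivAt (b p) (-(p.r * (p.lam * p.T))) 1 :=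
    ((hasDerivAt_exp_one (p.lam * p.T)).const_mul _).const_sub 1
  have hr := one_sub_r_ne_zero p
  refine (hb.div ha (by rwa [a_one])).congr_deriv ?_
  rw [a_one, b_one, backoffWeight, slotLoad]
  push_cast
  field_simp
  ring

theorem hasDerivAt_geom_sum_one (W : ℕ) :
    HasDerivAt (fun v : ℂ => ∑ i ∈ Finset.range (W + 1), v ^ i) ((W + 1) * W / 2) 1 := by
  have h : HasDerivAt (fun v : ℂ => ∑ i ∈ Finset.range (W + 1), v ^ i)
      (∑ i ∈ Finset.range (W + 1), (i : ℂ)) 1 :=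
    HasDerivAt.fun_sum fun i _ => by simpa using hasDerivAt_pow i (1 : ℂ)
  refine h.congr_deriv (eq_div_of_mul_eq two_ne_zero ?_)
  have hs := congrArg (Nat.cast : ℕ → ℂ) (Finset.sum_range_id_mul_two (W + 1))
  rwa [Nat.add_sub_cancel, Nat.cast_mul, Nat.cast_mul, Nat.cast_sum, Nat.cast_ofNat,
    Nat.cast_succ] at hs

/-- The first term contributes λT - 1. The subtracted quotient equals 1 at x = 1 and has logarithmic
derivative (W - W/2)u'(1) there, so it contributes `backoffWeight p * W / 2`. -/
theorem hasDerivAt_R (W : ℕ) (p : Params) :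
    HasDerivAt (R W p) ((p.lam * B W p - 1 : ℝ) : ℂ) 1 := by
  have hW : (W : ℂ) + 1 ≠ 0 := Nat.cast_add_one_ne_zero W
  have h1 := (hasDerivAt_exp_one (p.lam * p.T)).div (hasDerivAt_id (1 : ℂ)) one_ne_zero
  have hgeom : HasDerivAt (fun v : ℂ => ∑ i ∈ Finset.range (W + 1), v ^ i)
      ((W + 1) * W / 2) (u p 1) := by
    rw [u_one]; exact hasDerivAt_geom_sum_one W
  have h2 := hgeom.comp 1 (hasDerivAt_u p)
  have h3 := ((hasDerivAt_u p).fun_pow W).const_mul ((W : ℂ) + 1)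
  have h4 := h1.sub (h3.div h2 (by simp [u_one, hW]))
  refine h4.congr_deriv ?_
  rw [lam_mul_B]
  simp [u_one]
  field_simp
  ring

end Greedy

end

theorem mainTheorem1 (W : ℕ) :
    (∀ p : Greedy.Params,
      HasDerivAt (Greedy.R W p) ((p.lam * Greedy.B W p - 1 : ℝ) : ℂ) 1 ∧
      (MarkovChain.IsErgodic (Greedy.transition W p) ↔ p.lam * Greedy.B W p - 1 < 0) ∧
      (MarkovChain.IsErgodic (Greedy.transition W p) ↔
        p.lam < 1 / (p.T * (1 + p.r * W / (2 * (1 - p.r))) + W * p.σ / 2))) ∧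
    frontier {p : Greedy.Params | MarkovChain.IsErgodic (Greedy.transition W p)} =
      {p : Greedy.Params |
        p.lam * ((W * p.r + 2 * (1 - p.r)) * p.T + W * (1 - p.r) * p.σ) = 2 * (1 - p.r)} := by
  refine ⟨fun p => ⟨Greedy.hasDerivAt_R W p, ?_, ?_⟩, Greedy.frontier_isErgodic W⟩
  · rw [Greedy.isErgodic_iff, sub_neg]
  · rw [Greedy.isErgodic_iff, ← Greedy.B_eq, lt_div_iff₀ (Greedy.B_pos W p)]
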